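/- Let $\mathcal Q$ be a smooth Riemannian manifold (Hausdorff, second countable, without boundary), and let $G$ be a finite group acting freely on $\mathcal Q$ by smooth isometries. Let $\pi:\mathcal Q\to\mathcal Q/G$, $q\mapsto[q]$, be the canonical projection, where $\mathcal Q/G$ carries the quotient topology, the quotient smooth structure and the quotient Riemannian metric (those for which $\pi$ is a local diffeomorphism and a local isometry), and let $\operatorname{Vol}$ denote the Riemannian volume measure, with values in $[0,\infty]$, on $\mathcal Q$ and on $\mathcal Q/G$ respectively. Let $\mathcal Q_{\mathrm{free}}\subseteq\mathcal Q$ be a Lebesgue-measurable set (i.e. measurable for the completion of the volume measure) that is $G$-invariant: for all $g\in G$ and $q\in\mathcal Q$, $q\in\mathcal Q_{\mathrm{free}}\Leftrightarrow g\cdot q\in\mathcal Q_{\mathrm{free}}$. Write $\mathcal Q_{\mathrm{free}}/G=\pi(\mathcal Q_{\mathrm{free}})\subseteq\mathcal Q/G$. Then $\mathcal Q_{\mathrm{free}}/G$ is Lebesgue-measurable and $$\operatorname{Vol}(\mathcal Q_{\mathrm{free}}/G)=\frac{\operatorname{Vol}(\mathcal Q_{\mathrm{free}})}{|G|}.$$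 -/

import Mathlib

open Manifold Bundle MeasureTheory Set Filter Topology
open scoped ContDiff ENNReal

noncomputable section

section RiemannianVolume

/-! ### The Riemannian volume measure -/

variable (n : ℕ) (M : Type*) [TopologicalSpace M] [ChartedSpace (EuclideanSpace ℝ (Fin n)) M]
  [RiemannianBundle (fun x : M => TangentSpace (𝓡 n) x)]

variable {M} in
/-- The Gram matrix `g_ij(y) = ⟪∂_i, ∂_j⟫` of the Riemannian metric of `M` in the chart `e`, at the
point with coordinates `y`; here `∂_i` is the image of the `i`-th standard basis vector under the
differential of `e⁻¹` at `y`. -/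
def gramMatrix (e : OpenPartialHomeomorph M (EuclideanSpace ℝ (Fin n)))
    (y : EuclideanSpace ℝ (Fin n)) : Matrix (Fin n) (Fin n) ℝ :=
  Matrix.of fun i j =>
    inner ℝ
      (mfderiv (𝓡 n) (𝓡 n) e.symm y (EuclideanSpace.single i (1 : ℝ)) :
        TangentSpace (𝓡 n) (e.symm y))
      (mfderiv (𝓡 n) (𝓡 n) e.symm y (EuclideanSpace.single j (1 : ℝ)) :
        TangentSpace (𝓡 n) (e.symm y))

variable {M} in
/-- The Riemannian volume on the domain of the chart `e`: the measure
`A ↦ ∫_{e(A ∩ source)} √(det g_ij(y)) dy`. -/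
def chartVolume [MeasurableSpace M] (e : OpenPartialHomeomorph M (EuclideanSpace ℝ (Fin n))) :
    Measure M :=
  ((volume.restrict e.target).withDensity
    fun y => ENNReal.ofReal (√(gramMatrix n e y).det)).map e.symm

/-- The Riemannian volume measure of `M`. For a smooth Riemannian manifold, the measures
`chartVolume n e` of the charts of the atlas agree on overlaps by the change of variables formula;
they are glued together by taking their supremum in the lattice of Borel measures. If `M` is second
countable, this is the only Borel measure whose restriction to the domain of each chart `e` of the
atlas is `chartVolume n e`. -/
def riemannianVolume [MeasurableSpace M] [BorelSpace M] : Measure M :=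
  ⨆ e ∈ atlas (EuclideanSpace ℝ (Fin n)) M, chartVolume n e

end RiemannianVolume

section Quotient

/-! ### Quotients of Riemannian manifolds by finite groups of isometries -/

/-- The canonical projection `Q → Q / G`, `q ↦ [q]`. -/
def orbitProj (G : Type*) [Group G] {Q : Type*} [MulAction G Q] :
    Q → MulAction.orbitRel.Quotient G Q :=
  Quotient.mk (MulAction.orbitRel G Q)

/-- `G` acts on the Riemannian manifold `Q` by (smooth) isometries: every `q ↦ g • q` is smooth and
preserves the Riemannian metric. -/
class ActsByIsometries (n : ℕ) (G : Type*) [Group G] (Q : Type*) [TopologicalSpace Q]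
    [ChartedSpace (EuclideanSpace ℝ (Fin n)) Q]
    [RiemannianBundle (fun x : Q => TangentSpace (𝓡 n) x)] [MulAction G Q] : Prop where
  contMDiff_smul (g : G) : ContMDiff (𝓡 n) (𝓡 n) ∞ (fun x : Q => g • x)
  inner_mfderiv_smul (g : G) (x : Q) (v w : TangentSpace (𝓡 n) x) :
    inner ℝ
      (mfderiv (𝓡 n) (𝓡 n) (fun y : Q => g • y) x v : TangentSpace (𝓡 n) (g • x))
      (mfderiv (𝓡 n) (𝓡 n) (fun y : Q => g • y) x w : TangentSpace (𝓡 n) (g • x)) = inner ℝ v w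

theorem orbitProj_smul {G : Type*} [Group G] {Q : Type*} [MulAction G Q] (g : G) (x : Q) :
    orbitProj G (g • x) = orbitProj G x :=
  MulAction.orbitRel.Quotient.quotient_smul_eq

theorem orbitProj_eq_iff {G : Type*} [Group G] {Q : Type*} [MulAction G Q] {x y : Q} :
    orbitProj G x = orbitProj G y ↔ ∃ g : G, g • y = x :=
  Quotient.eq

theorem orbitProj_surjective {G : Type*} [Group G] {Q : Type*} [MulAction G Q] :
    Function.Surjective (orbitProj G : Q → _) :=
  Quotient.mk_surjective

theorem orbitProj_out {G : Type*} [Group G] {Q : Type*} [MulAction G Q]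
    (q : MulAction.orbitRel.Quotient G Q) : orbitProj G q.out = q :=
  Quotient.out_eq q

section Topology

variable {G : Type*} [Group G] [Finite G] {Q : Type*} [TopologicalSpace Q] [T2Space Q]
  [LocallyCompactSpace Q] [MulAction G Q] [ContinuousConstSMul G Q] [IsCancelSMul G Q]

theorem orbitProj_isLocalHomeomorph : IsLocalHomeomorph (orbitProj G : Q → _) :=
  isQuotientCoveringMap_quotientMk_of_properlyDiscontinuousSMul.isCoveringMap.isLocalHomeomorph

/-- A local section of the projection `Q → Q / G` near `q`: a homeomorphism from a neighbourhood of
`q` onto an open subset of `Q`, whose inverse is the projection. -/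
def localSection (q : MulAction.orbitRel.Quotient G Q) :
    OpenPartialHomeomorph (MulAction.orbitRel.Quotient G Q) Q :=
  orbitProj_isLocalHomeomorph.localInverseAt q.out

theorem mem_localSection_source (q : MulAction.orbitRel.Quotient G Q) :
    q ∈ (localSection q).source := by
  have h := (orbitProj_isLocalHomeomorph (G := G) (Q := Q)).apply_self_mem_localInverseAt_source
    (x := q.out)
  rwa [orbitProj_out] at h

/-- Along `Q`, any local inverse of the projection is given by the action of a group element. -/
theorem localInverseAt_orbitProj_eventuallyEq (p x : Q)
    (hx : orbitProj G x ∈ (orbitProj_isLocalHomeomorph.localInverseAt p).source) :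
    ∃ h : G, (fun y => (orbitProj_isLocalHomeomorph (G := G).localInverseAt p) (orbitProj G y))
      =ᶠ[𝓝 x] fun y => h • y := by
  have hl := orbitProj_isLocalHomeomorph (G := G) (Q := Q)
  set s := hl.localInverseAt p with hs
  obtain ⟨h, hh⟩ : ∃ h : G, h • x = s (orbitProj G x) :=
    orbitProj_eq_iff.1 (hl.apply_localInverseAt_of_mem hx)
  refine ⟨h, ?_⟩
  have h1 : ∀ᶠ y in 𝓝 x, h • y ∈ s.target := by
    refine (continuous_const_smul h).continuousAt.eventually_mem (s.open_target.mem_nhds ?_)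
    rw [hh]
    exact s.map_source hx
  have h2 : ∀ᶠ y in 𝓝 x, orbitProj G y ∈ s.source :=
    hl.continuous.continuousAt.eventually_mem (s.open_source.mem_nhds hx)
  filter_upwards [h1, h2] with y hy1 hy2
  refine hl.injOn_localInverseAt_target (s.map_source hy2) hy1 ?_
  rw [hl.apply_localInverseAt_of_mem hy2, orbitProj_smul]

instance [SecondCountableTopology Q] [MeasurableSpace Q] [BorelSpace Q] :
    BorelSpace (MulAction.orbitRel.Quotient G Q) := by
  have hl := orbitProj_isLocalHomeomorph (G := G) (Q := Q)
  have : SecondCountableTopology (MulAction.orbitRel.Quotient G Q) :=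
    isQuotientMap_quotient_mk'.secondCountableTopology hl.isOpenMap
  refine ⟨le_antisymm (fun A hA => ?_) (MeasurableSpace.generateFrom_le fun U hU => ?_)⟩
  · let mB : MeasurableSpace (MulAction.orbitRel.Quotient G Q) := borel _
    have : BorelSpace (MulAction.orbitRel.Quotient G Q) := ⟨rfl⟩
    have hA' : MeasurableSet (orbitProj G ⁻¹' A : Set Q) := hA
    obtain ⟨c, hc, hcU⟩ := TopologicalSpace.countable_cover_nhds
      (fun q : MulAction.orbitRel.Quotient G Q =>
        (localSection q).open_source.mem_nhds (mem_localSection_source q))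
    have key : A = ⋃ q ∈ c, Subtype.val ''
        ((fun z : (localSection q).source => localSection q z) ⁻¹' (orbitProj G ⁻¹' A)) := by
      ext z
      simp only [mem_iUnion, mem_image, mem_preimage, Subtype.exists, exists_and_right,
        exists_eq_right]
      constructor
      · intro hz
        have : z ∈ ⋃ q ∈ c, (localSection q).source := hcU ▸ mem_univ z
        obtain ⟨q, hq, hzq⟩ := mem_iUnion₂.1 this
        refine ⟨q, hq, hzq, ?_⟩
        rwa [localSection, hl.apply_localInverseAt_of_mem hzq]
      · rintro ⟨q, hq, hzq, hz⟩
        rwa [localSection, hl.apply_localInverseAt_of_mem hzq] at hz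
    change MeasurableSet A
    rw [key]
    refine MeasurableSet.biUnion hc fun q _ => ?_
    exact MeasurableSet.subtype_image (localSection q).open_source.measurableSet
      ((continuousOn_iff_continuous_domRestrict.1 (localSection q).continuousOn).measurable hA')
  · exact measurableSet_quotient.2 (IsOpen.preimage hl.continuous hU).measurableSet

/-- The charts of `Q / G` are the compositions of local sections of the projection with charts of
`Q`. -/
theorem exists_of_mem_atlas {n : ℕ} [ChartedSpace (EuclideanSpace ℝ (Fin n)) Q]
    {e : OpenPartialHomeomorph (MulAction.orbitRel.Quotient G Q) (EuclideanSpace ℝ (Fin n))}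
    (he : e ∈ atlas (EuclideanSpace ℝ (Fin n)) (MulAction.orbitRel.Quotient G Q)) :
    ∃ p : Q, e = (orbitProj_isLocalHomeomorph.localInverseAt p).trans
      (chartAt (EuclideanSpace ℝ (Fin n)) p) := by
  obtain ⟨q, rfl⟩ := he
  exact ⟨_, rfl⟩

end Topology

section Smooth

variable {n : ℕ} {G : Type*} [Group G] [Finite G] {Q : Type*} [TopologicalSpace Q] [T2Space Q]
  [LocallyCompactSpace Q] [ChartedSpace (EuclideanSpace ℝ (Fin n)) Q] [IsManifold (𝓡 n) ∞ Q]
  [RiemannianBundle (fun x : Q => TangentSpace (𝓡 n) x)] [MulAction G Q]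
  [ContinuousConstSMul G Q] [IsCancelSMul G Q] [ActsByIsometries n G Q]

variable (n G Q) in
/-- With the charts `φ ∘ s`, for `s` a local section of the projection and `φ` a chart of `Q`, the
quotient `Q / G` is a smooth manifold. -/
instance isManifold_quotient : IsManifold (𝓡 n) ∞ (MulAction.orbitRel.Quotient G Q) := by
  have hl := orbitProj_isLocalHomeomorph (G := G) (Q := Q)
  refine isManifold_of_contDiffOn _ _ _ ?_
  intro e e' he he'
  obtain ⟨p, rfl⟩ := exists_of_mem_atlas he
  obtain ⟨p', rfl⟩ := exists_of_mem_atlas he'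
  set φ := chartAt (EuclideanSpace ℝ (Fin n)) p with hφ
  set φ' := chartAt (EuclideanSpace ℝ (Fin n)) p' with hφ'
  intro y hy
  have hy1 := hy.1
  simp only [modelWithCornersSelf_coe_symm, preimage_id_eq, id_eq,
    OpenPartialHomeomorph.trans_source, OpenPartialHomeomorph.symm_source,
    OpenPartialHomeomorph.trans_target, mem_inter_iff, mem_preimage,
    OpenPartialHomeomorph.coe_trans_symm, Function.comp_apply,
    IsLocalHomeomorph.localInverseAt_symm] at hy1
  obtain ⟨⟨hy1, hy2⟩, hy3, hy4⟩ := hy1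
  obtain ⟨h, hh⟩ := localInverseAt_orbitProj_eventuallyEq p' (φ.symm y) hy3
  have hφm : φ ∈ IsManifold.maximalAtlas (𝓡 n) ∞ Q := IsManifold.chart_mem_maximalAtlas p
  have hφm' : φ' ∈ IsManifold.maximalAtlas (𝓡 n) ∞ Q := IsManifold.chart_mem_maximalAtlas p'
  have hc : ContMDiffAt (𝓡 n) (𝓡 n) ∞ φ.symm y := contMDiffAt_symm_of_mem_maximalAtlas hφm hy1
  have hy5 : h • φ.symm y ∈ φ'.source := by rw [← hh.eq_of_nhds]; exact hy4
  have hc2 : ContMDiffAt (𝓡 n) (𝓡 n) ∞ (fun z => φ' (h • φ.symm z)) y :=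
    (contMDiffAt_of_mem_maximalAtlas hφm' hy5).comp y
      (((ActsByIsometries.contMDiff_smul h).contMDiffAt).comp y hc)
  refine (contMDiffAt_iff_contDiffAt.1 (hc2.congr_of_eventuallyEq ?_)).contDiffWithinAt
  filter_upwards [hc.continuousAt.eventually hh] with z hz
  change φ' (hl.localInverseAt p' ((hl.localInverseAt p).symm (φ.symm z))) = _
  rw [hl.localInverseAt_symm]
  exact congrArg φ' hz

theorem contMDiff_orbitProj :
    ContMDiff (𝓡 n) (𝓡 n) ∞ (orbitProj G : Q → MulAction.orbitRel.Quotient G Q) := by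
  have hl := orbitProj_isLocalHomeomorph (G := G) (Q := Q)
  intro x
  refine contMDiffAt_iff_target.2 ⟨hl.continuous.continuousAt, ?_⟩
  have hs := mem_chart_source (EuclideanSpace ℝ (Fin n)) (orbitProj G x)
  have ha := chart_mem_atlas (EuclideanSpace ℝ (Fin n)) (orbitProj G x)
  obtain ⟨p, hp⟩ := exists_of_mem_atlas ha
  rw [hp, OpenPartialHomeomorph.trans_source] at hs
  obtain ⟨h, hh⟩ := localInverseAt_orbitProj_eventuallyEq p x hs.1
  have h5 : h • x ∈ (chartAt (EuclideanSpace ℝ (Fin n)) p).source := by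
    rw [← hh.eq_of_nhds]; exact hs.2
  have hc2 : ContMDiffAt (𝓡 n) (𝓡 n) ∞
      (fun z => chartAt (EuclideanSpace ℝ (Fin n)) p (h • z)) x :=
    (contMDiffAt_of_mem_maximalAtlas (IsManifold.chart_mem_maximalAtlas p) h5).comp x
      (ActsByIsometries.contMDiff_smul h).contMDiffAt
  refine hc2.congr_of_eventuallyEq ?_
  filter_upwards [hh] with z hz
  simp only [extChartAt, hp]
  exact congrArg (chartAt (EuclideanSpace ℝ (Fin n)) p) hz

theorem contMDiffAt_localSection (q : MulAction.orbitRel.Quotient G Q) :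
    ContMDiffAt (𝓡 n) (𝓡 n) ∞ (localSection q) q := by
  have hl := orbitProj_isLocalHomeomorph (G := G) (Q := Q)
  have hs := mem_chart_source (EuclideanSpace ℝ (Fin n)) q
  have ha := chart_mem_atlas (EuclideanSpace ℝ (Fin n)) q
  have hm : ContMDiffAt (𝓡 n) (𝓡 n) ∞ (chartAt (EuclideanSpace ℝ (Fin n)) q) q :=
    contMDiffAt_of_mem_maximalAtlas (IsManifold.chart_mem_maximalAtlas q) hs
  obtain ⟨p, hp⟩ := exists_of_mem_atlas ha
  rw [hp] at hs hm
  rw [OpenPartialHomeomorph.trans_source] at hs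
  set s := hl.localInverseAt p with hsdef
  set φ := chartAt (EuclideanSpace ℝ (Fin n)) p with hφ
  have hs1 : ContMDiffAt (𝓡 n) (𝓡 n) ∞ s q := by
    have h1 : ContMDiffAt (𝓡 n) (𝓡 n) ∞ φ.symm ((s.trans φ) q) :=
      contMDiffAt_symm_of_mem_maximalAtlas (IsManifold.chart_mem_maximalAtlas p)
        (φ.map_source hs.2)
    refine (h1.comp q hm).congr_of_eventuallyEq ?_
    filter_upwards [(s.continuousAt hs.1).eventually_mem (φ.open_source.mem_nhds hs.2)] with z hz
    exact (φ.left_inv hz).symm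
  have hq : orbitProj G (s q) = q := hl.apply_localInverseAt_of_mem hs.1
  obtain ⟨h, hh⟩ := localInverseAt_orbitProj_eventuallyEq q.out (s q)
    (by rw [hq]; exact mem_localSection_source q)
  refine (((ActsByIsometries.contMDiff_smul h).contMDiffAt (x := s q)).comp q
    hs1).congr_of_eventuallyEq ?_
  filter_upwards [(s.continuousAt hs.1).eventually hh, s.open_source.mem_nhds hs.1] with z hz hz2
  rw [hl.apply_localInverseAt_of_mem hz2] at hz
  exact hz

theorem orbitProj_localSection (q : MulAction.orbitRel.Quotient G Q) :
    orbitProj G (localSection q q) = q :=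
  orbitProj_isLocalHomeomorph.apply_localInverseAt_of_mem (mem_localSection_source q)

variable (n) in
/-- The differential at `q` of a local section of the projection, from `T_q (Q / G)` to the tangent
space of `Q` at a point of the orbit `q`. It is the inverse of the differential of the projection
at this point. -/
def liftTangent (q : MulAction.orbitRel.Quotient G Q) :
    TangentSpace (𝓡 n) q →L[ℝ] TangentSpace (𝓡 n) (localSection q q) :=
  mfderiv (𝓡 n) (𝓡 n) (localSection q) q

theorem mfderiv_comp_liftTangent (q : MulAction.orbitRel.Quotient G Q)
    (v : TangentSpace (𝓡 n) q) :
    mfderiv (𝓡 n) (𝓡 n) (orbitProj G) (localSection q q) (liftTangent n q v) = v := by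
  have h1 : MDifferentiableAt (𝓡 n) (𝓡 n) (localSection q) q :=
    (contMDiffAt_localSection q).mdifferentiableAt (by simp)
  have h2 : MDifferentiableAt (𝓡 n) (𝓡 n) (orbitProj G) (localSection q q) :=
    (contMDiff_orbitProj (n := n) (G := G) _).mdifferentiableAt (by simp)
  have h3 : (orbitProj G ∘ localSection q) =ᶠ[𝓝 q] id := by
    filter_upwards [(localSection q).open_source.mem_nhds (mem_localSection_source q)] with z hz
    exact orbitProj_isLocalHomeomorph.apply_localInverseAt_of_mem hz
  have h4 := mfderiv_comp q h2 h1
  rw [h3.mfderiv_eq, mfderiv_id] at h4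
  exact (DFunLike.congr_fun h4 v).symm

theorem liftTangent_comp_mfderiv (q : MulAction.orbitRel.Quotient G Q)
    (v : TangentSpace (𝓡 n) (localSection q q)) :
    (liftTangent n q (mfderiv (𝓡 n) (𝓡 n) (orbitProj G) (localSection q q) v) :
      TangentSpace (𝓡 n) (localSection q q)) = v := by
  have hq := orbitProj_localSection (G := G) (Q := Q) q
  have h1 : MDifferentiableAt (𝓡 n) (𝓡 n) (localSection q) (orbitProj G (localSection q q)) := by
    rw [hq]; exact (contMDiffAt_localSection q).mdifferentiableAt (by simp)
  have h2 : MDifferentiableAt (𝓡 n) (𝓡 n) (orbitProj G) (localSection q q) :=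
    (contMDiff_orbitProj (n := n) (G := G) _).mdifferentiableAt (by simp)
  have h3 : (localSection q ∘ orbitProj G) =ᶠ[𝓝 (localSection q q)] id := by
    filter_upwards [(localSection q).open_target.mem_nhds
      ((localSection q).map_source (mem_localSection_source q))] with z hz
    have := (localSection q).right_inv hz
    rwa [localSection, IsLocalHomeomorph.localInverseAt_symm] at this
  have h4 := mfderiv_comp (localSection q q) h1 h2
  rw [h3.mfderiv_eq, mfderiv_id, hq] at h4
  exact (DFunLike.congr_fun h4 v).symm

variable (n G Q) in
/-- The quotient Riemannian metric on `Q / G`: the scalar product of two tangent vectors of `Q / G`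
at `q` is the scalar product of their lifts to `Q`. -/
def quotientMetric :
    RiemannianMetric (fun q : MulAction.orbitRel.Quotient G Q => TangentSpace (𝓡 n) q) where
  inner q := (ContinuousLinearMap.precomp ℝ (liftTangent n q)).comp
    ((RiemannianBundle.g.inner (localSection q q)).comp (liftTangent n q))
  symm q v w := RiemannianBundle.g.symm (localSection q q) _ _
  pos q v hv := RiemannianBundle.g.pos (localSection q q) _ fun h => hv
    ((mfderiv_comp_liftTangent q v).symm.trans
      ((congrArg (mfderiv (𝓡 n) (𝓡 n) (orbitProj G) (localSection q q)) h).trans (map_zero _)))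
  continuousAt q := by
    have h := RiemannianBundle.g.continuousAt (E := fun x : Q => TangentSpace (𝓡 n) x)
      (localSection q q)
    rw [← map_zero (liftTangent n q)] at h
    exact ContinuousAt.comp (f := liftTangent n q) h (liftTangent n q).continuous.continuousAt
  isVonNBounded q := by
    have h := (RiemannianBundle.g.isVonNBounded (E := fun x : Q => TangentSpace (𝓡 n) x)
      (localSection q q)).image (mfderiv (𝓡 n) (𝓡 n) (orbitProj G) (localSection q q))
    refine Bornology.IsVonNBounded.subset (fun v hv => ?_) h
    exact ⟨liftTangent n q v, hv, mfderiv_comp_liftTangent q v⟩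

/-- `Q / G` is endowed with the quotient Riemannian metric. -/
instance : RiemannianBundle (fun q : MulAction.orbitRel.Quotient G Q => TangentSpace (𝓡 n) q) :=
  ⟨quotientMetric n G Q⟩

/-- The projection `Q → Q / G` is a local isometry; in particular the quotient metric does not
depend on the choice of local sections. -/
theorem inner_mfderiv_orbitProj (x : Q) (v w : TangentSpace (𝓡 n) x) :
    inner ℝ
      (mfderiv (𝓡 n) (𝓡 n) (orbitProj G) x v : TangentSpace (𝓡 n) (orbitProj G x))
      (mfderiv (𝓡 n) (𝓡 n) (orbitProj G) x w : TangentSpace (𝓡 n) (orbitProj G x)) =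
    inner ℝ v w := by
  set q := orbitProj G x with hqx
  have hs : orbitProj G x ∈ (localSection (orbitProj G x)).source := mem_localSection_source _
  obtain ⟨h, hh⟩ := localInverseAt_orbitProj_eventuallyEq (orbitProj G x).out x hs
  have h1 : MDifferentiableAt (𝓡 n) (𝓡 n) (localSection q) (orbitProj G x) :=
    (contMDiffAt_localSection q).mdifferentiableAt (by simp)
  have h2 : MDifferentiableAt (𝓡 n) (𝓡 n) (orbitProj G) x :=
    (contMDiff_orbitProj (n := n) (G := G) _).mdifferentiableAt (by simp)
  have h4 := mfderiv_comp x h1 h2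
  have h5 := Filter.EventuallyEq.mfderiv_eq (I := 𝓡 n) (I' := 𝓡 n) hh
  have hx : localSection q q = h • x := hh.eq_of_nhds
  rw [← ActsByIsometries.inner_mfderiv_smul (n := n) h x v w]
  have key : ∀ u : TangentSpace (𝓡 n) x,
      (liftTangent n q (mfderiv (𝓡 n) (𝓡 n) (orbitProj G) x u) : EuclideanSpace ℝ (Fin n)) =
        mfderiv (𝓡 n) (𝓡 n) (fun y : Q => h • y) x u := fun u =>
    (DFunLike.congr_fun h4 u).symm.trans (DFunLike.congr_fun h5 u)
  have base : ∀ (y y' : Q) (a b : EuclideanSpace ℝ (Fin n)), y = y' →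
      (RiemannianBundle.g (E := fun x : Q => TangentSpace (𝓡 n) x)).inner y a b =
      (RiemannianBundle.g (E := fun x : Q => TangentSpace (𝓡 n) x)).inner y' a b := by
    rintro y _ a b rfl; rfl
  change (RiemannianBundle.g (E := fun x : Q => TangentSpace (𝓡 n) x)).inner (localSection q q)
    (liftTangent n q (mfderiv (𝓡 n) (𝓡 n) (orbitProj G) x v))
    (liftTangent n q (mfderiv (𝓡 n) (𝓡 n) (orbitProj G) x w)) =
    (RiemannianBundle.g (E := fun x : Q => TangentSpace (𝓡 n) x)).inner (h • x)
      (mfderiv (𝓡 n) (𝓡 n) (fun y : Q => h • y) x v)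
      (mfderiv (𝓡 n) (𝓡 n) (fun y : Q => h • y) x w)
  refine Eq.trans ?_ (base _ _ _ _ hx)
  exact congrArg₂ (fun a b : EuclideanSpace ℝ (Fin n) =>
    (RiemannianBundle.g (E := fun x : Q => TangentSpace (𝓡 n) x)).inner (localSection q q) a b)
    (key v) (key w)

end Smooth

end Quotient

end

/-! The projection `π : Q → Q/G` is a local isometry, and local isometries preserve the volume of
measurable sets on which they are injective. If `π` is injective on a Borel set `A`, freeness makes
`π⁻¹(π A)` the disjoint union of the `|G|` translates `gA`, all of volume `Vol(A) = Vol(π A)`.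
Countably many local sections cover `Q/G`, so `π_* Vol = |G| · Vol` as Borel measures
(`map_orbitProj_riemannianVolume`). For an invariant Borel set this is already the claim. A
Lebesgue-measurable one is approximated from inside by a Borel set, since `π` maps null sets to null
sets (`riemannianVolume_orbitProj_image_null`).

Invariance of volume is the change of variables formula: under a local isometry the Gram
determinants of two charts differ by the square of the Jacobian (`chartVolume_eq_of_bijOn`). Applied
to the identity, this shows that the chart volumes agree on overlaps, so that their supremum
restricts to each of them (`riemannianVolume_eq_chartVolume`). Cutting into countably many
chart-sized pieces makes the invariance global (`riemannianVolume_image_eq`). -/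

/-! ### Local isometries and chart volumes. -/

section LocalIsometry

theorem measurableSet_target_inter_preimage_symm {n : ℕ} {M : Type*}
    [TopologicalSpace M] [MeasurableSpace M] [BorelSpace M]
    (e : OpenPartialHomeomorph M (EuclideanSpace ℝ (Fin n))) {A : Set M} (hA : MeasurableSet A) :
    MeasurableSet (e.target ∩ e.symm ⁻¹' A) := by
  have h := e.open_target.measurableSet.subtype_image
    ((continuousOn_iff_continuous_domRestrict.1 e.continuousOn_symm).measurable hA)
  rwa [domRestrict_eq, preimage_comp, Subtype.image_preimage_coe] at h

/-- The Riemannian metric at `x` as a bilinear form on the model space. -/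
noncomputable def metricForm (n : ℕ) {M : Type*} [TopologicalSpace M]
    [ChartedSpace (EuclideanSpace ℝ (Fin n)) M]
    [RiemannianBundle (fun x : M => TangentSpace (𝓡 n) x)] (x : M) :
    LinearMap.BilinForm ℝ (EuclideanSpace ℝ (Fin n)) :=
  LinearMap.mk₂ ℝ
    (fun v w => (RiemannianBundle.g (E := fun x : M => TangentSpace (𝓡 n) x)).inner x v w)
    (fun v v' w => DFunLike.congr_fun
      (map_add ((RiemannianBundle.g (E := fun x : M => TangentSpace (𝓡 n) x)).inner x) v v') w)
    (fun c v w => DFunLike.congr_fun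
      (map_smul ((RiemannianBundle.g (E := fun x : M => TangentSpace (𝓡 n) x)).inner x) c v) w)
    (fun v w w' =>
      map_add ((RiemannianBundle.g (E := fun x : M => TangentSpace (𝓡 n) x)).inner x v) w w')
    (fun c v w =>
      map_smul ((RiemannianBundle.g (E := fun x : M => TangentSpace (𝓡 n) x)).inner x v) c w)

variable {n : ℕ} {M : Type*} [TopologicalSpace M] [ChartedSpace (EuclideanSpace ℝ (Fin n)) M]
  [RiemannianBundle (fun x : M => TangentSpace (𝓡 n) x)]
  {N : Type*} [TopologicalSpace N] [ChartedSpace (EuclideanSpace ℝ (Fin n)) N]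
  [RiemannianBundle (fun x : N => TangentSpace (𝓡 n) x)]

variable (n) in
/-- A smooth map preserving the Riemannian metrics. -/
structure PreservesMetric (Φ : M → N) : Prop where
  contMDiff : ContMDiff (𝓡 n) (𝓡 n) ∞ Φ
  inner_mfderiv (x : M) (v w : TangentSpace (𝓡 n) x) :
    inner ℝ (mfderiv (𝓡 n) (𝓡 n) Φ x v : TangentSpace (𝓡 n) (Φ x))
      (mfderiv (𝓡 n) (𝓡 n) Φ x w : TangentSpace (𝓡 n) (Φ x)) = inner ℝ v w

/-- With `Φ = id`, invariance under local isometries becomes independence of the chart. -/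
theorem PreservesMetric.id : PreservesMetric n (id : M → M) where
  contMDiff := contMDiff_id
  inner_mfderiv x v w := by
    rw [mfderiv_id]
    rfl

/-- Typing the differential as an endomorphism `L` of the model space turns a change of coordinates
into a composition of bilinear forms, with no tangent spaces at varying points. -/
theorem gramMatrix_eq_toMatrix (e : OpenPartialHomeomorph M (EuclideanSpace ℝ (Fin n)))
    (y : EuclideanSpace ℝ (Fin n)) (L : EuclideanSpace ℝ (Fin n) →L[ℝ] EuclideanSpace ℝ (Fin n))
    (hL : L = mfderiv (𝓡 n) (𝓡 n) e.symm y) :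
    gramMatrix n e y = LinearMap.BilinForm.toMatrix
      (EuclideanSpace.basisFun (Fin n) ℝ).toBasis
      ((metricForm n (e.symm y)).comp L.toLinearMap L.toLinearMap) := by
  subst hL
  ext i j
  rw [LinearMap.BilinForm.toMatrix_apply]
  simp only [OrthonormalBasis.coe_toBasis, EuclideanSpace.basisFun_apply]
  rfl

/-- The Gram determinants of two charts related by a local isometry. -/
theorem det_gramMatrix_eq_of_preservesMetric {Φ : M → N} (hΦ : PreservesMetric n Φ)
    {e : OpenPartialHomeomorph M (EuclideanSpace ℝ (Fin n))}
    {e' : OpenPartialHomeomorph N (EuclideanSpace ℝ (Fin n))}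
    {τ : EuclideanSpace ℝ (Fin n) → EuclideanSpace ℝ (Fin n)} {y : EuclideanSpace ℝ (Fin n)}
    {τ' : EuclideanSpace ℝ (Fin n) →L[ℝ] EuclideanSpace ℝ (Fin n)}
    (he : MDifferentiableAt (𝓡 n) (𝓡 n) e.symm y)
    (he' : MDifferentiableAt (𝓡 n) (𝓡 n) e'.symm (τ y)) (hτ : HasFDerivAt τ τ' y)
    (h : e'.symm ∘ τ =ᶠ[𝓝 y] Φ ∘ e.symm) :
    (gramMatrix n e y).det = τ'.det ^ 2 * (gramMatrix n e' (τ y)).det := by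
  have hp : e'.symm (τ y) = Φ (e.symm y) := h.eq_of_nhds
  have hΦd : MDifferentiableAt (𝓡 n) (𝓡 n) Φ (e.symm y) :=
    (hΦ.contMDiff _).mdifferentiableAt (by simp)
  have hd1 := mfderiv_comp y hΦd he
  have hd2 := mfderiv_comp y he' hτ.differentiableAt.mdifferentiableAt
  have hd3 := h.mfderiv_eq (I := 𝓡 n) (I' := 𝓡 n)
  rw [mfderiv_eq_fderiv, hτ.fderiv] at hd2
  obtain ⟨L, hL⟩ : ∃ L : EuclideanSpace ℝ (Fin n) →L[ℝ] EuclideanSpace ℝ (Fin n),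
    L = mfderiv (𝓡 n) (𝓡 n) e.symm y := ⟨_, rfl⟩
  obtain ⟨L', hL'⟩ : ∃ L' : EuclideanSpace ℝ (Fin n) →L[ℝ] EuclideanSpace ℝ (Fin n),
    L' = mfderiv (𝓡 n) (𝓡 n) e'.symm (τ y) := ⟨_, rfl⟩
  obtain ⟨P, hP⟩ : ∃ P : EuclideanSpace ℝ (Fin n) →L[ℝ] EuclideanSpace ℝ (Fin n),
    P = mfderiv (𝓡 n) (𝓡 n) Φ (e.symm y) := ⟨_, rfl⟩
  have hc : L'.comp τ' = P.comp L := by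
    subst hL hL' hP
    exact hd2.symm.trans (hd3.trans hd1)
  have hiso : metricForm n (e.symm y) =
      (metricForm n (e'.symm (τ y))).comp P.toLinearMap P.toLinearMap := by
    rw [hp]
    ext v w
    subst hP
    exact (hΦ.inner_mfderiv (e.symm y) v w).symm
  -- Pulling back along `τ'` multiplies the matrix of the form by that of `τ'` on the right and its
  -- transpose on the left, whence the factor `τ'.det ^ 2`.
  have hform : (metricForm n (e.symm y)).comp L.toLinearMap L.toLinearMap =
      ((metricForm n (e'.symm (τ y))).comp L'.toLinearMap L'.toLinearMap).comp
        τ'.toLinearMap τ'.toLinearMap := by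
    rw [hiso]
    ext v w
    have hv : ∀ v, L' (τ' v) = P (L v) := fun v => DFunLike.congr_fun hc v
    simp [LinearMap.BilinForm.comp_apply, hv]
  rw [gramMatrix_eq_toMatrix e y L hL, gramMatrix_eq_toMatrix e' (τ y) L' hL', hform,
    LinearMap.BilinForm.toMatrix_comp (EuclideanSpace.basisFun (Fin n) ℝ).toBasis]
  rw [Matrix.det_mul, Matrix.det_mul, Matrix.det_transpose, LinearMap.det_toMatrix,
    ContinuousLinearMap.det]
  ring

theorem chartVolume_apply [MeasurableSpace M] [BorelSpace M]
    (e : OpenPartialHomeomorph M (EuclideanSpace ℝ (Fin n))) {A : Set M} (hA : MeasurableSet A) :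
    chartVolume n e A =
      ∫⁻ y in e.target ∩ e.symm ⁻¹' A, ENNReal.ofReal (√(gramMatrix n e y).det) := by
  -- Outside `e.target` nothing is known about `e.symm`, so only a.e. measurability for the
  -- restricted measure is available.
  have hm : AEMeasurable e.symm (volume.restrict e.target) :=
    e.continuousOn_symm.aemeasurable e.open_target.measurableSet
  rw [chartVolume, Measure.map_apply_of_aemeasurable
    (hm.mono_ac (withDensity_absolutelyContinuous _ _)) hA]
  rw [withDensity_apply', Measure.restrict_restrict' e.open_target.measurableSet, inter_comm]

/-- `e.symm` sends `e.target` into `e.source`, so no mass lies elsewhere. This reduces comparisons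
on arbitrary sets to subsets of the chart domain. -/
theorem chartVolume_restrict_source [MeasurableSpace M] [BorelSpace M]
    (e : OpenPartialHomeomorph M (EuclideanSpace ℝ (Fin n))) :
    (chartVolume n e).restrict e.source = chartVolume n e := by
  ext A hA
  rw [Measure.restrict_apply hA, chartVolume_apply e (hA.inter e.open_source.measurableSet),
    chartVolume_apply e hA]
  congr 2
  ext y
  simp only [mem_inter_iff, mem_preimage]
  exact ⟨fun h => ⟨h.1, h.2.1⟩, fun h => ⟨h.1, h.2, e.map_target h.1⟩⟩

variable [IsManifold (𝓡 n) ∞ M] [IsManifold (𝓡 n) ∞ N]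

/-- Local isometries preserve the volumes defined by charts. -/
theorem chartVolume_eq_of_bijOn [MeasurableSpace M] [BorelSpace M] [MeasurableSpace N]
    [BorelSpace N] {Φ : M → N} (hΦ : PreservesMetric n Φ)
    {e : OpenPartialHomeomorph M (EuclideanSpace ℝ (Fin n))}
    {e' : OpenPartialHomeomorph N (EuclideanSpace ℝ (Fin n))}
    (he : e ∈ atlas (EuclideanSpace ℝ (Fin n)) M) (he' : e' ∈ atlas (EuclideanSpace ℝ (Fin n)) N)
    {A : Set M} {B : Set N} (hA : MeasurableSet A) (hB : MeasurableSet B) (hAe : A ⊆ e.source)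
    (hBe : B ⊆ e'.source) (hAB : BijOn Φ A B) :
    chartVolume n e' B = chartVolume n e A := by
  have hm := IsManifold.subset_maximalAtlas (I := 𝓡 n) (n := ∞) he
  have hm' := IsManifold.subset_maximalAtlas (I := 𝓡 n) (n := ∞) he'
  -- The coordinate expression of `Φ`; it is injective from the coordinates of `A` onto those of
  -- `B`, so the change of variables formula applies to it.
  set τ : EuclideanSpace ℝ (Fin n) → EuclideanSpace ℝ (Fin n) := fun y => e' (Φ (e.symm y))
    with hτ
  have hsymm : ∀ y ∈ e.target, ContMDiffAt (𝓡 n) (𝓡 n) ∞ e.symm y := fun y hy =>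
    contMDiffAt_symm_of_mem_maximalAtlas hm hy
  have hΦB : ∀ y ∈ e.target ∩ e.symm ⁻¹' A, Φ (e.symm y) ∈ e'.source := fun y hy =>
    hBe (hAB.mapsTo hy.2)
  have hdiff : ∀ y ∈ e.target ∩ e.symm ⁻¹' A, HasFDerivAt τ (fderiv ℝ τ y) y := fun y hy => by
    have h : ContMDiffAt (𝓡 n) (𝓡 n) ∞ τ y :=
      (contMDiffAt_of_mem_maximalAtlas hm' (hΦB y hy)).comp y
        (hΦ.contMDiff.contMDiffAt.comp y (hsymm y hy.1))
    exact ((contMDiffAt_iff_contDiffAt.1 h).differentiableAt (by simp)).hasFDerivAt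
  have himage : τ '' (e.target ∩ e.symm ⁻¹' A) = e'.target ∩ e'.symm ⁻¹' B := by
    ext z
    constructor
    · rintro ⟨y, hy, rfl⟩
      refine ⟨e'.map_source (hΦB y hy), ?_⟩
      rw [mem_preimage, hτ, e'.left_inv (hΦB y hy)]
      exact hAB.mapsTo hy.2
    · rintro ⟨hz, hzB⟩
      obtain ⟨x, hx, hxz⟩ := hAB.surjOn hzB
      refine ⟨e x, ⟨e.map_source (hAe hx), ?_⟩, ?_⟩
      · rwa [mem_preimage, e.left_inv (hAe hx)]
      · rw [hτ]
        simp only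
        rw [e.left_inv (hAe hx), hxz, e'.right_inv hz]
  have hinj : InjOn τ (e.target ∩ e.symm ⁻¹' A) := fun y hy z hz hyz =>
    e.symm.injOn hy.1 hz.1
      (hAB.injOn hy.2 hz.2 (e'.injOn (hΦB y hy) (hΦB z hz) hyz))
  rw [chartVolume_apply e' hB, chartVolume_apply e hA, ← himage,
    lintegral_image_eq_lintegral_abs_det_fderiv_mul volume
      (measurableSet_target_inter_preimage_symm e hA)
      (fun y hy => (hdiff y hy).hasFDerivWithinAt) hinj]
  refine setLIntegral_congr_fun (measurableSet_target_inter_preimage_symm e hA) fun y hy => ?_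
  have hcont : ContinuousAt (fun z => Φ (e.symm z)) y :=
    hΦ.contMDiff.continuous.continuousAt.comp (hsymm y hy.1).continuousAt
  have hev : e'.symm ∘ τ =ᶠ[𝓝 y] Φ ∘ e.symm := by
    filter_upwards [hcont.eventually_mem (e'.open_source.mem_nhds (hΦB y hy))] with z hz
    exact e'.left_inv hz
  have hdet := det_gramMatrix_eq_of_preservesMetric hΦ
    ((hsymm y hy.1).mdifferentiableAt (by simp))
    ((contMDiffAt_symm_of_mem_maximalAtlas hm' (e'.map_source (hΦB y hy))).mdifferentiableAt
      (by simp)) (hdiff y hy) hev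
  -- The square root of the squared Jacobian is the factor `|det|` of the change of variables
  -- formula.
  rw [hdet, Real.sqrt_mul (sq_nonneg _), Real.sqrt_sq_eq_abs, ENNReal.ofReal_mul (abs_nonneg _)]

end LocalIsometry

/-! ### Gluing chart volumes into a global measure. -/

section Gluing

/-- Second countability extracts a countable cover by chart domains, which is then made disjoint.
Nonemptiness allows the cover to be indexed by `ℕ`. -/
theorem exists_measurable_partition_chart (n : ℕ) (M : Type*) [TopologicalSpace M]
    [SecondCountableTopology M] [MeasurableSpace M] [BorelSpace M]
    [ChartedSpace (EuclideanSpace ℝ (Fin n)) M] [Nonempty M] :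
    ∃ (f : ℕ → M) (D : ℕ → Set M), (∀ k, MeasurableSet (D k)) ∧
      Pairwise (Function.onFun Disjoint D) ∧ ⋃ k, D k = univ ∧
      ∀ k, D k ⊆ (chartAt (EuclideanSpace ℝ (Fin n)) (f k)).source := by
  obtain ⟨c, hc, hcU⟩ := TopologicalSpace.countable_cover_nhds
    (fun x : M => (chartAt (EuclideanSpace ℝ (Fin n)) x).open_source.mem_nhds
      (mem_chart_source (EuclideanSpace ℝ (Fin n)) x))
  have hne : c.Nonempty := by
    obtain ⟨x⟩ := ‹Nonempty M›
    obtain ⟨y, hy, -⟩ := mem_iUnion₂.1 (hcU ▸ mem_univ x)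
    exact ⟨y, hy⟩
  obtain ⟨f, rfl⟩ := hc.exists_eq_range hne
  refine ⟨f, disjointed fun k => (chartAt (EuclideanSpace ℝ (Fin n)) (f k)).source,
    MeasurableSet.disjointed fun k => (chartAt _ (f k)).open_source.measurableSet,
    disjoint_disjointed _, ?_, disjointed_subset _⟩
  rw [iUnion_disjointed]
  simpa using hcU

variable {n : ℕ} {M : Type*} [TopologicalSpace M] [SecondCountableTopology M]
  [MeasurableSpace M] [BorelSpace M] [ChartedSpace (EuclideanSpace ℝ (Fin n)) M]
  [IsManifold (𝓡 n) ∞ M] [RiemannianBundle (fun x : M => TangentSpace (𝓡 n) x)]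

/-- The Riemannian volume agrees with the volume defined by a chart on the domain of the chart. -/
theorem riemannianVolume_eq_chartVolume
    {e : OpenPartialHomeomorph M (EuclideanSpace ℝ (Fin n))}
    (he : e ∈ atlas (EuclideanSpace ℝ (Fin n)) M) {A : Set M} (hA : MeasurableSet A)
    (hAe : A ⊆ e.source) : riemannianVolume n M A = chartVolume n e A := by
  refine le_antisymm ?_ (Measure.le_iff'.1 (le_iSup₂_of_le e he le_rfl) A)
  rcases isEmpty_or_nonempty M with hM | hM
  · rw [eq_empty_of_isEmpty A, measure_empty]
    exact zero_le
  obtain ⟨f, D, hDm, hDd, hDU, hDs⟩ := exists_measurable_partition_chart n M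
  -- The glued measure, using one chart on each piece of the partition. It agrees with every chart
  -- volume on the chart's domain, hence bounds all of them and so their supremum.
  set ρ : Measure M := Measure.sum fun k =>
    (chartVolume n (chartAt (EuclideanSpace ℝ (Fin n)) (f k))).restrict (D k) with hρ
  have key : ∀ e ∈ atlas (EuclideanSpace ℝ (Fin n)) M, ∀ B, MeasurableSet B → B ⊆ e.source →
      ρ B = chartVolume n e B := by
    intro e he B hB hBe
    rw [hρ, Measure.sum_apply _ hB]
    calc ∑' k, (chartVolume n (chartAt (EuclideanSpace ℝ (Fin n)) (f k))).restrict (D k) B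
        = ∑' k, chartVolume n e (B ∩ D k) := by
          refine tsum_congr fun k => ?_
          rw [Measure.restrict_apply hB]
          exact chartVolume_eq_of_bijOn PreservesMetric.id he (chart_mem_atlas _ _)
            (hB.inter (hDm k)) (hB.inter (hDm k)) (inter_subset_left.trans hBe)
            (inter_subset_right.trans (hDs k)) (bijOn_id _)
      _ = chartVolume n e B := by
          rw [← measure_iUnion (fun i j hij => (hDd hij).mono inter_subset_right
            inter_subset_right) fun k => hB.inter (hDm k), ← inter_iUnion, hDU, inter_univ]
  rw [← key e he A hA hAe]
  refine Measure.le_iff'.1 (iSup₂_le fun e' he' => Measure.le_iff.2 fun B hB => ?_) A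
  rw [← chartVolume_restrict_source e', Measure.restrict_apply hB,
    ← key e' he' _ (hB.inter e'.open_source.measurableSet) inter_subset_right]
  exact measure_mono inter_subset_left

variable {N : Type*} [TopologicalSpace N] [SecondCountableTopology N]
  [MeasurableSpace N] [BorelSpace N] [ChartedSpace (EuclideanSpace ℝ (Fin n)) N]
  [IsManifold (𝓡 n) ∞ N] [RiemannianBundle (fun x : N => TangentSpace (𝓡 n) x)]

/-- Injective local isometries preserve the Riemannian volume. -/
theorem riemannianVolume_image_eq {Φ : M → N} (hΦ : PreservesMetric n Φ)
    (hΦm : ∀ A, MeasurableSet A → MeasurableSet (Φ '' A)) {A : Set M} (hA : MeasurableSet A)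
    (hinj : InjOn Φ A) : riemannianVolume n N (Φ '' A) = riemannianVolume n M A := by
  rcases isEmpty_or_nonempty M with hM | hM
  · simp [eq_empty_of_isEmpty A]
  have hN : Nonempty N := hM.map Φ
  obtain ⟨f, D, hDm, hDd, hDU, hDs⟩ := exists_measurable_partition_chart n M
  obtain ⟨f', D', hDm', hDd', hDU', hDs'⟩ := exists_measurable_partition_chart n N
  -- Each piece lies in one chart domain of `M` and its image in one chart domain of `N`;
  -- injectivity on `A` keeps the images disjoint.
  set P : ℕ × ℕ → Set M := fun k => A ∩ (D k.1 ∩ Φ ⁻¹' D' k.2) with hP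
  have hPm : ∀ k, MeasurableSet (P k) := fun k =>
    hA.inter ((hDm k.1).inter (hΦ.contMDiff.continuous.measurable (hDm' k.2)))
  have hPA : ∀ k, P k ⊆ A := fun k => inter_subset_left
  have hPd : Pairwise (Function.onFun Disjoint P) := by
    intro k l hkl
    by_cases h : k.1 = l.1
    · have h2 : k.2 ≠ l.2 := fun h2 => hkl (Prod.ext h h2)
      exact ((hDd' h2).preimage Φ).mono (fun x hx => hx.2.2) fun x hx => hx.2.2
    · exact (hDd h).mono (fun x hx => hx.2.1) fun x hx => hx.2.1
  have hPU : ⋃ k, P k = A := by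
    refine subset_antisymm (iUnion_subset hPA) fun x hx => ?_
    obtain ⟨i, hi⟩ := mem_iUnion.1 (hDU ▸ mem_univ x)
    obtain ⟨j, hj⟩ := mem_iUnion.1 (hDU' ▸ mem_univ (Φ x))
    exact mem_iUnion.2 ⟨(i, j), hx, hi, hj⟩
  have hPd' : Pairwise (Function.onFun Disjoint fun k => Φ '' P k) := fun k l hkl =>
    (hPd hkl).image hinj (hPA k) (hPA l)
  rw [← hPU, image_iUnion, measure_iUnion hPd' fun k => hΦm _ (hPm k), measure_iUnion hPd hPm]
  refine tsum_congr fun k => ?_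
  have hsub : Φ '' P k ⊆ D' k.2 := by
    rintro _ ⟨x, hx, rfl⟩
    exact hx.2.2
  rw [riemannianVolume_eq_chartVolume (chart_mem_atlas _ _) (hΦm _ (hPm k))
      (hsub.trans (hDs' k.2)),
    riemannianVolume_eq_chartVolume (chart_mem_atlas _ _) (hPm k)
      (Subset.trans (fun x hx => hx.2.1) (hDs k.1))]
  exact chartVolume_eq_of_bijOn hΦ (chart_mem_atlas _ _) (chart_mem_atlas _ _) (hPm k)
    (hΦm _ (hPm k)) (Subset.trans (fun x hx => hx.2.1) (hDs k.1)) (hsub.trans (hDs' k.2))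
    (hinj.mono (hPA k)).bijOn_image

end Gluing

/-! ### Volume under the quotient projection. -/

section FiniteQuotient

theorem preimage_orbitProj_image (G : Type*) [Group G] {Q : Type*} [MulAction G Q] (A : Set Q) :
    orbitProj G ⁻¹' (orbitProj G '' A) = ⋃ g : G, (fun x => g • x) '' A := by
  ext x
  simp only [mem_preimage, mem_image, mem_iUnion, orbitProj_eq_iff]
  constructor
  · rintro ⟨y, hy, g, rfl⟩
    exact ⟨g⁻¹, g • x, hy, inv_smul_smul g x⟩
  · rintro ⟨g, y, hy, rfl⟩
    exact ⟨y, hy, g⁻¹, inv_smul_smul g y⟩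

/-- Measurability in the quotient σ-algebra is tested on the preimage, here a finite union of
translates under homeomorphisms. -/
theorem measurableSet_orbitProj_image {G : Type*} [Group G] [Finite G] {Q : Type*}
    [TopologicalSpace Q] [MeasurableSpace Q] [BorelSpace Q] [MulAction G Q]
    [ContinuousConstSMul G Q] {A : Set Q} (hA : MeasurableSet A) :
    MeasurableSet (orbitProj G '' A) := by
  refine measurableSet_quotient.2 ?_
  change MeasurableSet (orbitProj G ⁻¹' (orbitProj G '' A))
  rw [preimage_orbitProj_image]
  exact MeasurableSet.iUnion fun g =>
    (Homeomorph.smul g).toMeasurableEquiv.measurableEmbedding.measurableSet_image' hA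

variable {n : ℕ} {Q : Type*} [TopologicalSpace Q] [ChartedSpace (EuclideanSpace ℝ (Fin n)) Q]
  [RiemannianBundle (fun x : Q => TangentSpace (𝓡 n) x)]
  {G : Type*} [Group G] [MulAction G Q] [ActsByIsometries n G Q]

theorem preservesMetric_smul (g : G) : PreservesMetric n (fun x : Q => g • x) :=
  ⟨ActsByIsometries.contMDiff_smul g, ActsByIsometries.inner_mfderiv_smul g⟩

variable [IsManifold (𝓡 n) ∞ Q] [ContinuousConstSMul G Q]

theorem preservesMetric_orbitProj [T2Space Q] [LocallyCompactSpace Q] [Finite G]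
    [IsCancelSMul G Q] :
    PreservesMetric n (orbitProj G : Q → MulAction.orbitRel.Quotient G Q) :=
  ⟨contMDiff_orbitProj, inner_mfderiv_orbitProj⟩

variable [SecondCountableTopology Q] [MeasurableSpace Q] [BorelSpace Q]

theorem riemannianVolume_smul (g : G) {A : Set Q} (hA : MeasurableSet A) :
    riemannianVolume n Q ((fun x => g • x) '' A) = riemannianVolume n Q A :=
  riemannianVolume_image_eq (preservesMetric_smul g)
    (fun _ hB =>
      (Homeomorph.smul g).toMeasurableEquiv.measurableEmbedding.measurableSet_image' hB) hA
    (MulAction.injective g).injOn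

variable [Finite G] [IsCancelSMul G Q]

/-- If `gx = hy` with `x, y ∈ A`, injectivity of the projection gives `x = y`, and freeness then
gives `g = h`. The translates of `A` are therefore disjoint, and they have equal volume. -/
theorem riemannianVolume_preimage_orbitProj_of_injOn {A : Set Q} (hA : MeasurableSet A)
    (hinj : InjOn (orbitProj G) A) :
    riemannianVolume n Q (orbitProj G ⁻¹' (orbitProj G '' A)) =
      Nat.card G * riemannianVolume n Q A := by
  have hd : Pairwise (Function.onFun Disjoint fun g : G => (fun x : Q => g • x) '' A) := by
    intro g h hgh
    refine disjoint_left.2 ?_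
    rintro _ ⟨x, hx, rfl⟩ ⟨y, hy, hxy⟩
    simp only at hxy
    have hyx : y = x := hinj hy hx (by
      rw [← orbitProj_smul h y, hxy, orbitProj_smul])
    subst hyx
    exact hgh (IsCancelSMul.right_cancel _ _ _ hxy).symm
  rw [preimage_orbitProj_image, measure_iUnion hd fun g =>
    (Homeomorph.smul g).toMeasurableEquiv.measurableEmbedding.measurableSet_image' hA]
  have := Fintype.ofFinite G
  simp [riemannianVolume_smul _ hA, tsum_fintype]

variable [T2Space Q] [LocallyCompactSpace Q]

/-- The projection to the quotient by a finite group multiplies the Riemannian volume by the order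
of the group. -/
theorem map_orbitProj_riemannianVolume :
    (riemannianVolume n Q).map (orbitProj G) =
      (Nat.card G : ℝ≥0∞) • riemannianVolume n (MulAction.orbitRel.Quotient G Q) := by
  have hl := orbitProj_isLocalHomeomorph (G := G) (Q := Q)
  have : SecondCountableTopology (MulAction.orbitRel.Quotient G Q) :=
    isQuotientMap_quotient_mk'.secondCountableTopology hl.isOpenMap
  obtain ⟨c, hc, hcU⟩ := TopologicalSpace.countable_cover_nhds
    (fun q : MulAction.orbitRel.Quotient G Q =>
      (localSection q).open_source.mem_nhds (mem_localSection_source q))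
  refine (Measure.ext_iff_of_biUnion_eq_univ hc hcU).2 fun q _ => Measure.ext fun B hB => ?_
  have hBm := hB.inter (localSection q).open_source.measurableSet
  rw [Measure.restrict_apply hB, Measure.restrict_apply hB,
    Measure.map_apply hl.continuous.measurable hBm, Measure.smul_apply, smul_eq_mul]
  set C := B ∩ (localSection q).source
  -- The lift of `C` by the local section: a single sheet, mapped bijectively onto `C`.
  set A : Set Q := (localSection q).target ∩ orbitProj G ⁻¹' C with hA
  have hAm : MeasurableSet A :=
    (localSection q).open_target.measurableSet.inter (hl.continuous.measurable hBm)
  have hinj : InjOn (orbitProj G) A := (hl.injOn_localInverseAt_target).mono inter_subset_left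
  have himage : orbitProj G '' A = C := by
    refine subset_antisymm ?_ fun z hz => ?_
    · rintro _ ⟨x, hx, rfl⟩
      exact hx.2
    · have hz' : orbitProj G (localSection q z) = z := hl.apply_localInverseAt_of_mem hz.2
      exact ⟨localSection q z, ⟨(localSection q).map_source hz.2, by rwa [mem_preimage, hz']⟩, hz'⟩
  rw [← himage, riemannianVolume_preimage_orbitProj_of_injOn hAm hinj,
    riemannianVolume_image_eq preservesMetric_orbitProj
      (fun _ h => measurableSet_orbitProj_image h) hAm hinj]

/-- A null measurable hull of `A` has a saturation made of finitely many null translates. The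
pushforward formula gives `|G|` times the volume of its image as `0`, and `|G| ≠ 0`. -/
theorem riemannianVolume_orbitProj_image_null {A : Set Q} (hA : riemannianVolume n Q A = 0) :
    riemannianVolume n (MulAction.orbitRel.Quotient G Q) (orbitProj G '' A) = 0 := by
  have hm := measurableSet_toMeasurable (riemannianVolume n Q) A
  refine measure_mono_null (image_mono (subset_toMeasurable (riemannianVolume n Q) A)) ?_
  have h := congrArg (fun ρ => ρ (orbitProj G '' toMeasurable (riemannianVolume n Q) A))
    (map_orbitProj_riemannianVolume (n := n) (Q := Q) (G := G))
  rw [Measure.map_apply (orbitProj_isLocalHomeomorph (G := G) (Q := Q)).continuous.measurable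
    (measurableSet_orbitProj_image hm), Measure.smul_apply, smul_eq_mul, preimage_orbitProj_image,
    measure_iUnion_null fun g => ?_] at h
  · exact (mul_eq_zero.1 h.symm).resolve_left (by simp [Nat.card_pos.ne'])
  · rw [riemannianVolume_smul g hm, measure_toMeasurable, hA]

end FiniteQuotient

/-! ### Lebesgue-measurable invariant sets. -/

theorem mainTheorem3 {n : ℕ}
    {Q : Type*} [TopologicalSpace Q] [T2Space Q] [SecondCountableTopology Q]
    [LocallyCompactSpace Q] [MeasurableSpace Q] [BorelSpace Q]
    [ChartedSpace (EuclideanSpace ℝ (Fin n)) Q] [IsManifold (𝓡 n) ∞ Q]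
    [RiemannianBundle (fun x : Q => TangentSpace (𝓡 n) x)]
    [IsContMDiffRiemannianBundle (𝓡 n) ∞ (EuclideanSpace ℝ (Fin n))
      (fun x : Q => TangentSpace (𝓡 n) x)]
    {G : Type*} [Group G] [Finite G] [MulAction G Q] [ContinuousConstSMul G Q]
    [IsCancelSMul G Q] [ActsByIsometries n G Q]
    (Qfree : Set Q) (hmeas : NullMeasurableSet Qfree (riemannianVolume n Q))
    (hinv : ∀ (g : G) (q : Q), q ∈ Qfree ↔ g • q ∈ Qfree) :
    NullMeasurableSet (orbitProj G '' Qfree)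
        (riemannianVolume n (MulAction.orbitRel.Quotient G Q)) ∧
      riemannianVolume n (MulAction.orbitRel.Quotient G Q) (orbitProj G '' Qfree) =
        riemannianVolume n Q Qfree / (Nat.card G : ℝ≥0∞) := by
  obtain ⟨B, hBQ, hBm, hBae⟩ := hmeas.exists_measurable_subset_ae_eq
  have himage : orbitProj G '' B =ᵐ[riemannianVolume n (MulAction.orbitRel.Quotient G Q)]
      orbitProj G '' Qfree := by
    refine ae_eq_set.2 ⟨by simp [sdiff_eq_empty.2 (image_mono hBQ)], ?_⟩
    refine measure_mono_null ?_ (riemannianVolume_orbitProj_image_null (ae_eq_set.1 hBae).2)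
    rintro _ ⟨⟨x, hx, rfl⟩, hxB⟩
    exact mem_image_of_mem _ ⟨hx, fun h => hxB (mem_image_of_mem _ h)⟩
  -- `B` need not be invariant, but invariance of `Qfree` traps the saturation of `B` between `B`
  -- and `Qfree`, which have the same volume.
  have hpre : orbitProj G ⁻¹' (orbitProj G '' B) ⊆ Qfree := by
    rw [preimage_orbitProj_image]
    refine iUnion_subset fun g => ?_
    rintro _ ⟨x, hx, rfl⟩
    exact (hinv g x).1 (hBQ hx)
  have hvol : riemannianVolume n Q (orbitProj G ⁻¹' (orbitProj G '' B)) =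
      riemannianVolume n Q Qfree :=
    le_antisymm (measure_mono hpre)
      ((measure_congr hBae).symm.le.trans (measure_mono (subset_preimage_image _ _)))
  refine ⟨(measurableSet_orbitProj_image hBm).nullMeasurableSet.congr himage, ?_⟩
  -- Cancelling `|G|` needs only `0 < |G| < ∞`, so infinite volumes are covered.
  rw [← measure_congr himage, ← hvol,
    ← Measure.map_apply (orbitProj_isLocalHomeomorph (G := G) (Q := Q)).continuous.measurable
      (measurableSet_orbitProj_image hBm), map_orbitProj_riemannianVolume, Measure.smul_apply,
    smul_eq_mul, mul_comm, ENNReal.mul_div_cancel_right (by simp [Nat.card_pos.ne']) (ENNReal.natCast_ne_top _)]
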